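/- Let $\mathcal G=(V,\mathcal E)$ be a finite connected simple graph with at least one edge. In the unbiased quantized consensus dynamics on $\mathcal G$, agent $i\in V$ holds an integer opinion $x_i(t)$ at time $t=0,1,2,\dots$. At each step an edge $\{i,j\}$ is chosen uniformly at random from $\mathcal E$, independently of the past choices. Then $$x_i(t+1)=\begin{cases}x_i(t)-1 & \text{if } x_i(t)>x_j(t),\\ x_i(t)+1 & \text{if } x_i(t)<x_j(t),\\ x_i(t) & \text{if } x_i(t)=x_j(t),\end{cases}$$ the same rule with $i$ and $j$ exchanged gives $x_j(t+1)$, and all other opinions stay unchanged. The update is called nontrivial if $|x_i(t)-x_j(t)|\ge 2$. Let $T_1(x(0))$ be the number of edge selections up to and including the first one that produces a nontrivial update, when the initial profile is $x(0)$. Let $\mathcal X(\mathcal G)$ be the set of profiles in which exactly one entry is $0$, exactly one entry is $2$, and all remaining entries are $1$. Define $$\bar T(\mathcal G)=\max_{x(0)\in\mathcal X(\mathcal G)}\mathbb E\big[T_1(x(0))\big].$$ Then there are absolute constants $0<C_1<C_2$ such that $$C_1n^3\le \bar T(\mathcal G)\le C_2n^3$$ whenever $\mathcal G$ is the line graph (that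 is, the path) on $n\ge 2$ nodes, and whenever $\mathcal G$ is the cycle on $n\ge 3$ nodes. -/

import Mathlib

open MeasureTheory
open scoped ENNReal

namespace QuantizedConsensus

variable {V : Type*}

/-- Every set of (unordered) pairs of nodes is an event. -/
instance instMeasurableSpaceSym2 : MeasurableSpace (Sym2 V) := ⊤

/-- The new opinion of an agent with opinion `a` whose partner on the chosen edge has
opinion `b`. -/
def newOpinion (a b : ℤ) : ℤ :=
  if b < a then a - 1 else if a < b then a + 1 else a

open Classical in
/-- The opinion profile after the edge `e` has been chosen in the profile `x`: the two endpoints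
of `e` update simultaneously, all other agents keep their opinions. -/
noncomputable def step (x : V → ℤ) (e : Sym2 V) : V → ℤ := fun k =>
  if h : k ∈ e then newOpinion (x k) (x (Sym2.Mem.other h)) else x k

/-- The opinion profile `x(t)` with initial profile `x₀`, when the edge chosen to pass from
`x(t)` to `x(t + 1)` is `ω t`. -/
noncomputable def profile (x₀ : V → ℤ) (ω : ℕ → Sym2 V) : ℕ → V → ℤ
  | 0 => x₀
  | t + 1 => step (profile x₀ ω t) (ω t)

/-- Choosing the edge `e` in the profile `x` gives a nontrivial update: the opinions of the two
endpoints differ by at least 2. -/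
def IsNontrivial (x : V → ℤ) (e : Sym2 V) : Prop :=
  ∃ i j : V, e = s(i, j) ∧ 2 ≤ |x i - x j|

/-- The time `T₁(x₀)` of the first nontrivial update along the edge sequence `ω`, i.e. the number
of edge selections up to and including the first nontrivial one (`∞` if there is none). -/
noncomputable def firstNontrivialTime (x₀ : V → ℤ) (ω : ℕ → Sym2 V) : ℝ≥0∞ :=
  ⨅ (t : ℕ) (_ : IsNontrivial (profile x₀ ω t) (ω t)), ((t + 1 : ℕ) : ℝ≥0∞)

/-- The law of a sequence of independent, uniformly distributed edges of the (finite,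
nonempty) edge set of `G`. -/
noncomputable def edgeSequenceLaw (G : SimpleGraph V) : Measure (ℕ → Sym2 V) :=
  Measure.infinitePi fun _ : ℕ => ProbabilityTheory.uniformOn G.edgeSet

/-- The set of profiles in which one entry is 0, one entry is 2, and the remaining
entries are 1. -/
def extremalProfiles (V : Type*) : Set (V → ℤ) :=
  {x | ∃ i j : V, i ≠ j ∧ x i = 0 ∧ x j = 2 ∧ ∀ k, k ≠ i → k ≠ j → x k = 1}

/-- `T̄(G)`: the maximum, over all initial profiles with one entry 0, one entry 2 and
all other entries 1, of the expected time of the first nontrivial update. For a finite graph the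
supremum runs over finitely many profiles. -/
noncomputable def maxExpectedTime (G : SimpleGraph V) : ℝ≥0∞ :=
  ⨆ x₀ ∈ extremalProfiles V, ∫⁻ ω, firstNontrivialTime x₀ ω ∂(edgeSequenceLaw G)

end QuantizedConsensus

namespace QuantizedConsensus

/-! In these profiles the entries 0 and 2 act as two walkers: an edge joining a walker to a 1 moves
the walker along it, and the update is nontrivial exactly when the edge joining the walkers is
chosen (`isNontrivial_pairProfile`, `step_pairProfile`). So `T₁` is a killing time of a finite
Markov chain on ordered pairs of distinct nodes, and its mean solves a discrete Poisson equation.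

A nonnegative supersolution of that equation bounds the mean from above
(`lintegral_firstNontrivialTime_le`), a subsolution bounded above bounds it from below
(`le_lintegral_firstNontrivialTime`). Explicit quadratics serve: on the cycle one function of the
difference is an exact solution (`edgeSum_cyclePotential`); on the path the quadratic is exact
except at adjacent walkers, where the additive constant `c` decides the sign of the defect
(`edgeSum_pathPotential`). The number of edges times a quadratic gives the order `n ^ 3`. -/

/-! ### Splitting off the first term of an i.i.d. sequence -/

/-- The sequence with first term `e` followed by `ω`. -/
def consSeq {α : Type*} (p : α × (ℕ → α)) : ℕ → α
  | 0 => p.1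
  | t + 1 => p.2 t

lemma measurable_consSeq {α : Type*} [MeasurableSpace α] :
    Measurable (consSeq : α × (ℕ → α) → ℕ → α) := by
  refine measurable_pi_lambda _ fun t => ?_
  cases t with
  | zero => exact measurable_fst
  | succ t => exact (measurable_pi_apply t).comp measurable_snd

/-- A sequence of i.i.d. variables is an independent pair of its first term and a sequence with
the same law. -/
lemma map_consSeq_infinitePi {α : Type*} [MeasurableSpace α] (ν : Measure α)
    [IsProbabilityMeasure ν] :
    (ν.prod (Measure.infinitePi fun _ : ℕ => ν)).map consSeq =
      Measure.infinitePi fun _ : ℕ => ν := by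
  classical
  refine Measure.eq_infinitePi _ fun s t ht => ?_
  rw [Measure.map_apply measurable_consSeq
    (MeasurableSet.pi s.countable_toSet fun i _ => ht i)]
  have key : consSeq ⁻¹' (Set.pi (s : Set ℕ) t) =
      (if 0 ∈ s then t 0 else Set.univ) ×ˢ
        Set.pi ((s.preimage Nat.succ Nat.succ_injective.injOn : Finset ℕ) : Set ℕ)
          (fun i => t (i + 1)) := by
    ext ⟨e, ω⟩
    simp only [Set.mem_preimage, Set.mem_pi, Finset.mem_coe, Set.mem_prod, Finset.mem_preimage]
    constructor
    · intro h
      refine ⟨?_, fun i hi => h (i + 1) hi⟩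
      split_ifs with h0
      · exact h 0 h0
      · trivial
    · rintro ⟨h0, h⟩ i hi
      cases i with
      | zero =>
        rw [if_pos hi] at h0
        exact h0
      | succ i => exact h i hi
  rw [key, Measure.prod_prod, Measure.infinitePi_pi _ (fun i _ => ht (i + 1))]
  -- Index 0 lies outside the range of the shift, so its factor is set to 1 here and supplied by
  -- `h2`.
  have h1 : ∏ i ∈ s.preimage Nat.succ Nat.succ_injective.injOn, ν (t (i + 1)) =
      ∏ i ∈ s, if i = 0 then 1 else ν (t i) := by
    rw [← Finset.prod_preimage Nat.succ s Nat.succ_injective.injOn]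
    · simp
    · rintro (_ | i) _ hi
      · simp
      · exact absurd ⟨i, rfl⟩ hi
  have h2 : ν (if 0 ∈ s then t 0 else Set.univ) = ∏ i ∈ s, if i = 0 then ν (t i) else 1 := by
    rw [Finset.prod_ite_eq' s 0 fun i => ν (t i)]
    split_ifs <;> simp
  rw [h1, h2, ← Finset.prod_mul_distrib]
  refine Finset.prod_congr rfl fun i _ => ?_
  split_ifs <;> simp

/-! ### Survival probabilities and the first-step recursion -/

variable {V : Type*}

/-- The event that the first `t` edge selections produce only trivial updates. -/
def survivalEvent (x : V → ℤ) (t : ℕ) : Set (ℕ → Sym2 V) :=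
  {ω | ∀ s < t, ¬ IsNontrivial (profile x ω s) (ω s)}

/-- Layer-cake identity `T = ∑ 1{T > t}`, which turns the expectation into a sum of survival
probabilities. -/
lemma firstNontrivialTime_eq_tsum (x : V → ℤ) (ω : ℕ → Sym2 V) :
    firstNontrivialTime x ω = ∑' t : ℕ, (survivalEvent x t).indicator 1 ω := by
  classical
  by_cases h : ∃ t, IsNontrivial (profile x ω t) (ω t)
  · have hmem : ∀ t, ω ∈ survivalEvent x t ↔ t < Nat.find h + 1 := by
      intro t
      simp only [survivalEvent, Set.mem_ofPred_eq, Nat.lt_succ_iff, Nat.le_find_iff]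
    have h1 : firstNontrivialTime x ω = ((Nat.find h + 1 : ℕ) : ℝ≥0∞) := by
      refine le_antisymm (iInf₂_le (Nat.find h) (Nat.find_spec h)) (le_iInf₂ fun t ht => ?_)
      exact_mod_cast Nat.succ_le_succ (Nat.find_min' h ht)
    rw [h1, tsum_eq_sum (s := Finset.range (Nat.find h + 1))]
    · rw [Finset.sum_congr rfl (g := fun _ => (1 : ℝ≥0∞))]
      · simp
      · intro t ht
        simp [Set.indicator, hmem, Finset.mem_range.1 ht]
    · intro t ht
      simp only [Set.indicator, hmem, ← Finset.mem_range, if_neg ht]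
  · push Not at h
    have h1 : firstNontrivialTime x ω = ⊤ := by
      simp [firstNontrivialTime, h]
    have h2 : ∀ t, (survivalEvent x t).indicator (1 : (ℕ → Sym2 V) → ℝ≥0∞) ω = 1 := by
      intro t
      simp [survivalEvent, h]
    simp only [h1, h2]
    exact (ENNReal.tsum_const_eq_top_of_ne_zero one_ne_zero).symm

lemma profile_consSeq (x : V → ℤ) (p : Sym2 V × (ℕ → Sym2 V)) (t : ℕ) :
    profile x (consSeq p) (t + 1) = profile (step x p.1) p.2 t := by
  induction t with
  | zero => rfl
  | succ t ih =>
    rw [profile, ih]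
    rfl

lemma consSeq_mem_survivalEvent (x : V → ℤ) (e : Sym2 V) (ω : ℕ → Sym2 V) (t : ℕ) :
    consSeq (e, ω) ∈ survivalEvent x (t + 1) ↔
      ¬ IsNontrivial x e ∧ ω ∈ survivalEvent (step x e) t := by
  constructor
  · intro h
    refine ⟨h 0 t.succ_pos, fun s hs => ?_⟩
    have := h (s + 1) (Nat.succ_lt_succ hs)
    rwa [profile_consSeq] at this
  · rintro ⟨h0, h⟩ s hs
    cases s with
    | zero => exact h0
    | succ s =>
      rw [profile_consSeq]
      exact h s (Nat.lt_of_succ_lt_succ hs)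

lemma measurableSet_survivalEvent [Countable V] (x : V → ℤ) (t : ℕ) :
    MeasurableSet (survivalEvent x t) := by
  induction t generalizing x with
  | zero => simp [survivalEvent]
  | succ t ih =>
    have : Countable (Sym2 V) := Quot.mk_surjective.countable
    -- Conditioning on the first edge writes the event as a countable union.
    have key : survivalEvent x (t + 1) = ⋃ e ∈ {e | ¬ IsNontrivial x e},
        ((fun ω : ℕ → Sym2 V => ω 0) ⁻¹' {e}) ∩
          ((fun (ω : ℕ → Sym2 V) s => ω (s + 1)) ⁻¹' survivalEvent (step x e) t) := by
      ext ω
      have hω : consSeq (ω 0, fun s => ω (s + 1)) = ω := by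
        ext s
        cases s <;> rfl
      rw [← hω, consSeq_mem_survivalEvent]
      simp [consSeq]
    rw [key]
    refine MeasurableSet.biUnion (Set.to_countable _) fun e _ => ?_
    refine ((measurable_pi_apply 0) (MeasurableSpace.measurableSet_top)).inter
      ((measurable_pi_lambda _ fun s => measurable_pi_apply (s + 1)) (ih _))

/-- The probability that the first `t` edge selections produce only trivial updates. -/
noncomputable def survivalProb (G : SimpleGraph V) (x : V → ℤ) (t : ℕ) : ℝ :=
  (edgeSequenceLaw G).real (survivalEvent x t)

lemma survivalProb_nonneg (G : SimpleGraph V) (x : V → ℤ) (t : ℕ) : 0 ≤ survivalProb G x t :=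
  measureReal_nonneg

lemma isProbabilityMeasure_uniformOn_edgeSet [Finite V] (G : SimpleGraph V)
    (hG : G.edgeSet.Nonempty) :
    IsProbabilityMeasure (ProbabilityTheory.uniformOn G.edgeSet) :=
  ProbabilityTheory.isProbabilityMeasure_uniformOn (Set.toFinite _) hG

section

variable [Fintype V] (G : SimpleGraph V) [Fintype G.edgeSet]

omit [Fintype G.edgeSet] in
lemma survivalProb_zero (hG : G.edgeSet.Nonempty) (x : V → ℤ) : survivalProb G x 0 = 1 := by
  have := isProbabilityMeasure_uniformOn_edgeSet G hG
  have h : survivalEvent x 0 = Set.univ := by simp [survivalEvent]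
  simp [survivalProb, h, edgeSequenceLaw]

lemma lintegral_uniformOn_edgeSet (f : Sym2 V → ℝ≥0∞) :
    ∫⁻ e, f e ∂(ProbabilityTheory.uniformOn G.edgeSet) =
      (∑ e ∈ G.edgeFinset, f e) / (G.edgeFinset.card : ℝ≥0∞) := by
  classical
  have : Fintype (Sym2 V) := inferInstance
  have hs : MeasurableSet G.edgeSet := MeasurableSpace.measurableSet_top
  rw [lintegral_fintype, ENNReal.div_eq_inv_mul, Finset.mul_sum, ← Finset.sum_subset
    (Finset.subset_univ G.edgeFinset)]
  · refine Finset.sum_congr rfl fun e he => ?_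
    have h1 : G.edgeSet ∩ {e} = {e} := by
      ext a; simp only [Set.mem_inter_iff, Set.mem_singleton_iff, and_iff_right_iff_imp]
      rintro rfl; exact SimpleGraph.mem_edgeFinset.1 he
    rw [ProbabilityTheory.uniformOn, ProbabilityTheory.cond_apply hs, h1,
      Measure.count_singleton, mul_one, mul_comm, ← SimpleGraph.coe_edgeFinset,
      Measure.count_apply_finset]
  · intro e _ he
    have h1 : G.edgeSet ∩ {e} = ∅ := by
      ext a; simp only [Set.mem_inter_iff, Set.mem_singleton_iff, Set.mem_empty_iff_false,
        iff_false, not_and]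
      rintro ha rfl; exact he (SimpleGraph.mem_edgeFinset.2 ha)
    rw [ProbabilityTheory.uniformOn, ProbabilityTheory.cond_apply hs, h1]
    simp

open Classical in
lemma survivalProb_succ (hG : G.edgeSet.Nonempty) (x : V → ℤ) (t : ℕ) :
    survivalProb G x (t + 1) =
      (∑ e ∈ G.edgeFinset, if IsNontrivial x e then 0 else survivalProb G (step x e) t) /
        G.edgeFinset.card := by
  have := isProbabilityMeasure_uniformOn_edgeSet G hG
  have key : edgeSequenceLaw G (survivalEvent x (t + 1)) =
      ∫⁻ e, (if IsNontrivial x e then 0 else edgeSequenceLaw G (survivalEvent (step x e) t))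
        ∂(ProbabilityTheory.uniformOn G.edgeSet) := by
    conv_lhs => rw [edgeSequenceLaw, ← map_consSeq_infinitePi]
    rw [Measure.map_apply measurable_consSeq (measurableSet_survivalEvent x _),
      Measure.prod_apply (measurable_consSeq (measurableSet_survivalEvent x _))]
    refine lintegral_congr fun e => ?_
    have h : Prod.mk e ⁻¹' (consSeq ⁻¹' survivalEvent x (t + 1)) =
        {ω | ¬ IsNontrivial x e ∧ ω ∈ survivalEvent (step x e) t} := by
      ext ω; exact consSeq_mem_survivalEvent x e ω t
    rw [h]
    split_ifs with hn
    · simp [hn]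
    · simp [hn, edgeSequenceLaw]
  rw [survivalProb, Measure.real, key, lintegral_uniformOn_edgeSet, ENNReal.toReal_div,
    ENNReal.toReal_natCast, ENNReal.toReal_sum]
  · congr 1
    refine Finset.sum_congr rfl fun e _ => ?_
    split_ifs <;> rfl
  · intro e _
    split_ifs
    · exact ENNReal.zero_ne_top
    · rw [edgeSequenceLaw]; exact measure_ne_top _ _

omit [Fintype G.edgeSet] in
lemma lintegral_firstNontrivialTime (hG : G.edgeSet.Nonempty) (x : V → ℤ) :
    ∫⁻ ω, firstNontrivialTime x ω ∂(edgeSequenceLaw G) =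
      ∑' t, ENNReal.ofReal (survivalProb G x t) := by
  have := isProbabilityMeasure_uniformOn_edgeSet G hG
  simp only [firstNontrivialTime_eq_tsum]
  rw [lintegral_tsum fun t =>
    (measurable_one.indicator (measurableSet_survivalEvent x t)).aemeasurable]
  refine tsum_congr fun t => ?_
  rw [lintegral_indicator_one (measurableSet_survivalEvent x t), survivalProb,
    ofReal_measureReal (by rw [edgeSequenceLaw]; exact measure_ne_top _ _)]

end

/-! ### Reduction to two walkers -/

section

open Classical in
/-- The profile with opinion `0` at `i`, opinion `2` at `j`, and opinion `1` elsewhere. -/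
noncomputable def pairProfile (i j : V) : V → ℤ := fun k =>
  if k = i then 0 else if k = j then 2 else 1

open Classical in
/-- The node which a walker sitting at `k` moves to when the edge `e` is chosen. -/
noncomputable def move (e : Sym2 V) (k : V) : V :=
  if h : k ∈ e then Sym2.Mem.other h else k

lemma other_mk_left (a b : V) (h : a ∈ s(a, b)) : Sym2.Mem.other h = b := by
  have := Sym2.other_spec h
  rw [Sym2.eq_iff] at this
  grind

lemma other_mk_right (a b : V) (h : b ∈ s(a, b)) : Sym2.Mem.other h = a := by
  have := Sym2.other_spec h
  rw [Sym2.eq_iff] at this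
  grind

open Classical in
lemma move_mk (a b k : V) : move s(a, b) k = if k = a then b else if k = b then a else k := by
  unfold move
  by_cases ha : k = a
  · subst ha
    rw [dif_pos (by simp), other_mk_left, if_pos rfl]
  · by_cases hb : k = b
    · subst hb
      rw [dif_pos (by simp), other_mk_right, if_neg ha, if_pos rfl]
    · simp [ha, hb]

open Classical in
lemma step_mk (x : V → ℤ) (a b k : V) : step x s(a, b) k =
    if k = a then newOpinion (x a) (x b) else if k = b then newOpinion (x b) (x a) else x k := by
  unfold step
  by_cases ha : k = a
  · subst ha
    rw [dif_pos (by simp), other_mk_left, if_pos rfl]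
  · by_cases hb : k = b
    · subst hb
      rw [dif_pos (by simp), other_mk_right, if_neg ha, if_pos rfl]
    · simp [ha, hb]

lemma isNontrivial_pairProfile {i j : V} (hij : i ≠ j) (e : Sym2 V) :
    IsNontrivial (pairProfile i j) e ↔ e = s(i, j) := by
  constructor
  · rintro ⟨a, b, rfl, h⟩
    simp only [pairProfile] at h
    rw [Sym2.eq_iff]
    split_ifs at h <;> simp_all
  · rintro rfl
    exact ⟨i, j, rfl, by simp [pairProfile, hij.symm]⟩

lemma step_pairProfile {i j : V} (hij : i ≠ j) {e : Sym2 V} (hd : ¬ e.IsDiag)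
    (he : e ≠ s(i, j)) :
    step (pairProfile i j) e = pairProfile (move e i) (move e j) := by
  induction e with
  | h a b =>
    rw [Sym2.mk_isDiag_iff] at hd
    rw [Ne, Sym2.eq_iff] at he
    funext k
    rw [step_mk, move_mk, move_mk]
    simp only [pairProfile, newOpinion]
    grind

lemma move_ne {i j : V} (hij : i ≠ j) {e : Sym2 V} : move e i ≠ move e j := by
  induction e with
  | h a b =>
    simp only [move_mk]
    grind

lemma mem_extremalProfiles {x : V → ℤ} :
    x ∈ extremalProfiles V ↔ ∃ i j, i ≠ j ∧ x = pairProfile i j := by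
  constructor
  · rintro ⟨i, j, hij, h0, h2, h1⟩
    refine ⟨i, j, hij, funext fun k => ?_⟩
    simp only [pairProfile]
    split_ifs <;> simp_all
  · rintro ⟨i, j, hij, rfl⟩
    refine ⟨i, j, hij, ?_⟩
    simp +contextual [pairProfile, hij.symm]

end

/-! ### Comparison with supersolutions and subsolutions -/

section

variable [Fintype V] [DecidableEq V] (G : SimpleGraph V) [Fintype G.edgeSet]

/-- The sum of `Φ` over the pairs of positions which the chosen edge can lead to from `(i, j)`
without a nontrivial update. -/
noncomputable def edgeSum (Φ : V → V → ℝ) (i j : V) : ℝ :=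
  ∑ e ∈ G.edgeFinset, if e = s(i, j) then 0 else Φ (move e i) (move e j)

omit [Fintype V] in
lemma edgeSum_mono {Φ Ψ : V → V → ℝ} (h : ∀ i j, i ≠ j → Φ i j ≤ Ψ i j) {i j : V}
    (hij : i ≠ j) : edgeSum G Φ i j ≤ edgeSum G Ψ i j := by
  refine Finset.sum_le_sum fun e _ => ?_
  split_ifs
  · exact le_rfl
  · exact h _ _ (move_ne hij)

lemma survivalProb_pairProfile_succ (hG : G.edgeSet.Nonempty) {i j : V} (hij : i ≠ j) (t : ℕ) :
    survivalProb G (pairProfile i j) (t + 1) =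
      edgeSum G (fun i j => survivalProb G (pairProfile i j) t) i j / G.edgeFinset.card := by
  rw [survivalProb_succ G hG, edgeSum]
  congr 1
  refine Finset.sum_congr rfl fun e he => ?_
  simp only [isNontrivial_pairProfile hij]
  split_ifs with h
  · rfl
  · rw [step_pairProfile hij (G.not_isDiag_of_mem_edgeFinset he) h]

/-- First-step equation for the truncated mean `E[min(T, N + 1)]`; the truncation keeps everything
finite and allows induction on `N`. -/
lemma sum_survivalProb_succ (hG : G.edgeSet.Nonempty) {i j : V} (hij : i ≠ j) (N : ℕ) :
    ∑ t ∈ Finset.range (N + 1), survivalProb G (pairProfile i j) t =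
      1 + edgeSum G (fun i j => ∑ t ∈ Finset.range N, survivalProb G (pairProfile i j) t) i j /
        G.edgeFinset.card := by
  rw [Finset.sum_range_succ', survivalProb_zero G hG, add_comm]
  simp only [survivalProb_pairProfile_succ G hG hij]
  rw [← Finset.sum_div]
  congr 2
  simp only [edgeSum]
  rw [Finset.sum_comm]
  refine Finset.sum_congr rfl fun e _ => ?_
  split_ifs <;> simp

omit [Fintype V] [DecidableEq V] in
lemma card_edgeFinset_pos (hG : G.edgeSet.Nonempty) : (0 : ℝ) < G.edgeFinset.card := by
  rw [Nat.cast_pos, Finset.card_pos]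
  obtain ⟨e, he⟩ := hG
  exact ⟨e, SimpleGraph.mem_edgeFinset.2 he⟩

lemma sum_survivalProb_le (hG : G.edgeSet.Nonempty) {Φ : V → V → ℝ}
    (h0 : ∀ i j, i ≠ j → 0 ≤ Φ i j)
    (h : ∀ i j, i ≠ j → G.edgeFinset.card + edgeSum G Φ i j ≤ G.edgeFinset.card * Φ i j)
    (N : ℕ) (i j : V) (hij : i ≠ j) :
    ∑ t ∈ Finset.range N, survivalProb G (pairProfile i j) t ≤ Φ i j := by
  have hm := card_edgeFinset_pos G hG
  induction N generalizing i j with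
  | zero => simpa using h0 i j hij
  | succ N ih =>
    rw [sum_survivalProb_succ G hG hij, ← le_sub_iff_add_le', div_le_iff₀ hm]
    have := edgeSum_mono G ih hij
    have := h i j hij
    linarith

/-- A nonnegative supersolution bounds the expected time from above. -/
lemma lintegral_firstNontrivialTime_le (hG : G.edgeSet.Nonempty) {Φ : V → V → ℝ}
    (h0 : ∀ i j, i ≠ j → 0 ≤ Φ i j)
    (h : ∀ i j, i ≠ j → G.edgeFinset.card + edgeSum G Φ i j ≤ G.edgeFinset.card * Φ i j)
    {i j : V} (hij : i ≠ j) :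
    ∫⁻ ω, firstNontrivialTime (pairProfile i j) ω ∂(edgeSequenceLaw G) ≤
      ENNReal.ofReal (Φ i j) := by
  rw [lintegral_firstNontrivialTime G hG, ENNReal.tsum_eq_iSup_nat]
  refine iSup_le fun N => ?_
  rw [← ENNReal.ofReal_sum_of_nonneg fun t _ => survivalProb_nonneg G _ t]
  exact ENNReal.ofReal_le_ofReal (sum_survivalProb_le G hG h0 h N i j hij)

/-- A subsolution need not lie below the truncated mean; on survival to time `N` it contributes at
most `K`, hence the extra term. -/
lemma le_sum_survivalProb (hG : G.edgeSet.Nonempty) {Φ : V → V → ℝ} {K : ℝ}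
    (hK : ∀ i j, i ≠ j → Φ i j ≤ K)
    (h : ∀ i j, i ≠ j → G.edgeFinset.card * Φ i j ≤ G.edgeFinset.card + edgeSum G Φ i j)
    (N : ℕ) (i j : V) (hij : i ≠ j) :
    Φ i j ≤ ∑ t ∈ Finset.range N, survivalProb G (pairProfile i j) t +
      K * survivalProb G (pairProfile i j) N := by
  have hm := card_edgeFinset_pos G hG
  induction N generalizing i j with
  | zero => simpa [survivalProb_zero G hG] using hK i j hij
  | succ N ih =>
    have h1 := edgeSum_mono G ih hij
    have h2 : edgeSum G (fun i j => ∑ t ∈ Finset.range N, survivalProb G (pairProfile i j) t +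
        K * survivalProb G (pairProfile i j) N) i j =
        edgeSum G (fun i j => ∑ t ∈ Finset.range N, survivalProb G (pairProfile i j) t) i j +
        K * edgeSum G (fun i j => survivalProb G (pairProfile i j) N) i j := by
      simp only [edgeSum, Finset.mul_sum, ← Finset.sum_add_distrib]
      refine Finset.sum_congr rfl fun e _ => ?_
      split_ifs <;> simp
    rw [sum_survivalProb_succ G hG hij, survivalProb_pairProfile_succ G hG hij, add_assoc,
      ← mul_div_assoc, ← add_div, ← sub_le_iff_le_add', le_div_iff₀ hm, ← h2]
    have := h i j hij
    linarith

/-- A subsolution which is bounded above bounds the expected time from below. -/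
lemma le_lintegral_firstNontrivialTime (hG : G.edgeSet.Nonempty) {Φ : V → V → ℝ} {K : ℝ}
    (hK : ∀ i j, i ≠ j → Φ i j ≤ K)
    (h : ∀ i j, i ≠ j → G.edgeFinset.card * Φ i j ≤ G.edgeFinset.card + edgeSum G Φ i j)
    {i j : V} (hij : i ≠ j) :
    ENNReal.ofReal (Φ i j) ≤
      ∫⁻ ω, firstNontrivialTime (pairProfile i j) ω ∂(edgeSequenceLaw G) := by
  rw [lintegral_firstNontrivialTime G hG]
  -- An infinite mean leaves nothing to prove; a finite one forces the survival probabilities to 0,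
  -- which removes the `K` term in the limit.
  by_cases hT : ∑' t, ENNReal.ofReal (survivalProb G (pairProfile i j) t) = ⊤
  · rw [hT]
    exact le_top
  · have hs : Summable fun t => survivalProb G (pairProfile i j) t := by
      have := ENNReal.summable_toReal hT
      simpa only [ENNReal.toReal_ofReal (survivalProb_nonneg G _ _)] using this
    rw [← ENNReal.ofReal_tsum_of_nonneg (survivalProb_nonneg G _) hs]
    refine ENNReal.ofReal_le_ofReal ?_
    have h1 := hs.hasSum.tendsto_sum_nat.add (hs.tendsto_atTop_zero.const_mul K)
    rw [mul_zero, add_zero] at h1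
    exact ge_of_tendsto' h1 fun N => le_sum_survivalProb G hG hK h N i j hij

/-- The sum over the chosen edge, in terms of the neighbours of the two positions. -/
lemma edgeSum_sub [DecidableRel G.Adj] (Φ : V → V → ℝ) {i j : V} (hij : i ≠ j) :
    edgeSum G Φ i j - G.edgeFinset.card * Φ i j =
      ∑ k ∈ G.neighborFinset i, ((if k = j then 0 else Φ k j) - Φ i j) +
        ∑ k ∈ G.neighborFinset j with k ≠ i, (Φ i k - Φ i j) := by
  have inj : ∀ a : V, Function.Injective fun b => s(a, b) := fun a b c h => by
    rw [Sym2.eq_iff] at h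
    grind
  have himg : ∀ a, G.incidenceFinset a = (G.neighborFinset a).image fun b => s(a, b) := by
    intro a
    ext e
    induction e with
    | h b c =>
      simp only [SimpleGraph.mem_incidenceFinset, Finset.mem_image,
        SimpleGraph.mem_neighborFinset, SimpleGraph.mk'_mem_incidenceSet_iff, Sym2.eq_iff]
      constructor
      · rintro ⟨h, rfl | rfl⟩
        · exact ⟨c, h, by simp⟩
        · exact ⟨b, h.symm, by simp⟩
      · rintro ⟨d, h, ⟨rfl, rfl⟩ | ⟨rfl, rfl⟩⟩
        · exact ⟨h, by simp⟩
        · exact ⟨h.symm, by simp⟩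
  set h : Sym2 V → ℝ := fun e => (if e = s(i, j) then 0 else Φ (move e i) (move e j)) - Φ i j
    with hh
  have h1 : edgeSum G Φ i j - G.edgeFinset.card * Φ i j = ∑ e ∈ G.edgeFinset, h e := by
    simp [edgeSum, hh, Finset.sum_sub_distrib]
  -- An edge touching neither walker contributes 0. The edge `s(i, j)` is kept in the star of `i`
  -- and dropped from that of `j`, so it counts once.
  have h2 : ∑ e ∈ G.edgeFinset, h e = ∑ e ∈ G.incidenceFinset i ∪
      ((G.neighborFinset j).filter (· ≠ i)).image fun b => s(j, b), h e := by
    symm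
    refine Finset.sum_subset ?_ ?_
    · refine Finset.union_subset (G.incidenceFinset_subset i) ?_
      refine (Finset.image_subset_image (Finset.filter_subset _ _)).trans ?_
      rw [← himg]
      exact G.incidenceFinset_subset j
    · intro e he hne
      induction e with
      | h a b =>
        simp only [Finset.mem_union, SimpleGraph.mem_incidenceFinset,
          SimpleGraph.mk'_mem_incidenceSet_iff, Finset.mem_image, Finset.mem_filter,
          SimpleGraph.mem_neighborFinset, Sym2.eq_iff, not_or, not_exists] at hne
        rw [SimpleGraph.mem_edgeFinset, SimpleGraph.mem_edgeSet] at he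
        have hia : i ≠ a := fun h => hne.1 ⟨he, Or.inl h⟩
        have hib : i ≠ b := fun h => hne.1 ⟨he, Or.inr h⟩
        have hja : j ≠ a := by
          rintro rfl
          exact hne.2 b ⟨⟨he, hib.symm⟩, by simp⟩
        have hjb : j ≠ b := by
          rintro rfl
          exact hne.2 a ⟨⟨he.symm, hia.symm⟩, by simp⟩
        simp [hh, move_mk, hia, hib, hja, hjb, hia.symm, hib.symm]
  rw [h1, h2, Finset.sum_union, himg, Finset.sum_image (inj i).injOn,
    Finset.sum_image (inj j).injOn]
  · congr 1
    · refine Finset.sum_congr rfl fun k hk => ?_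
      have hki : k ≠ i := by
        rintro rfl
        simp at hk
      simp only [hh, move_mk, Sym2.eq_iff]
      grind
    · refine Finset.sum_congr rfl fun k hk => ?_
      rw [Finset.mem_filter] at hk
      simp only [hh, move_mk, Sym2.eq_iff]
      grind
  · rw [Finset.disjoint_left]
    intro e he
    simp only [Finset.mem_image, Finset.mem_filter, not_exists, not_and]
    rintro k ⟨-, hk⟩ rfl
    rw [SimpleGraph.mem_incidenceFinset, SimpleGraph.mk'_mem_incidenceSet_iff] at he
    rcases he.2 with h | h
    · exact hij h
    · exact hk h.symm

end

/-! ### The path -/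

section Path

lemma sum_neighborFinset_pathGraph {n : ℕ} [DecidableRel (SimpleGraph.pathGraph n).Adj]
    (i : Fin n) (f : Fin n → ℝ) :
    ∑ k ∈ (SimpleGraph.pathGraph n).neighborFinset i, f k =
      (if h : i.val + 1 < n then f ⟨i.val + 1, h⟩ else 0) +
        (if 0 < i.val then f ⟨i.val - 1, by omega⟩ else 0) := by
  have h1 : (SimpleGraph.pathGraph n).neighborFinset i =
      Finset.univ.filter (fun k : Fin n => i.val + 1 = k.val) ∪
        Finset.univ.filter (fun k : Fin n => k.val + 1 = i.val) := by
    ext k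
    simp [SimpleGraph.pathGraph_adj]
  rw [h1, Finset.sum_union]
  · congr 1
    · split_ifs with h
      · have : Finset.univ.filter (fun k : Fin n => i.val + 1 = k.val) = {⟨i.val + 1, h⟩} := by
          ext k
          simp [Fin.ext_iff, eq_comm]
        rw [this, Finset.sum_singleton]
      · refine Finset.sum_eq_zero fun k hk => ?_
        have := (Finset.mem_filter.1 hk).2
        omega
    · split_ifs with h
      · have : Finset.univ.filter (fun k : Fin n => k.val + 1 = i.val) =
            {⟨i.val - 1, by omega⟩} := by
          ext k
          simp only [Finset.mem_filter, Finset.mem_univ, true_and, Finset.mem_singleton,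
            Fin.ext_iff]
          omega
        rw [this, Finset.sum_singleton]
      · refine Finset.sum_eq_zero fun k hk => ?_
        have := (Finset.mem_filter.1 hk).2
        omega
  · rw [Finset.disjoint_left]
    intro k hk hk'
    have := (Finset.mem_filter.1 hk).2
    have := (Finset.mem_filter.1 hk').2
    omega

lemma card_edgeFinset_pathGraph (N : ℕ) [Fintype (SimpleGraph.pathGraph (N + 1)).edgeSet] :
    ((SimpleGraph.pathGraph (N + 1)).edgeFinset.card : ℝ) = N := by
  classical
  have h := (SimpleGraph.pathGraph (N + 1)).sum_degrees_eq_twice_card_edges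
  have h1 : ∀ i, ((SimpleGraph.pathGraph (N + 1)).degree i : ℝ) =
      (if i.val + 1 < N + 1 then 1 else 0) + (if 0 < i.val then 1 else 0) := by
    intro i
    have := sum_neighborFinset_pathGraph i fun _ => (1 : ℝ)
    simpa using this
  have h2 : (∑ i, ((SimpleGraph.pathGraph (N + 1)).degree i : ℝ)) = N + N := by
    simp only [h1, Finset.sum_add_distrib]
    congr 1
    · rw [Fin.sum_univ_castSucc]
      simp
    · rw [Fin.sum_univ_succ]
      simp
  have h3 : (∑ i, ((SimpleGraph.pathGraph (N + 1)).degree i : ℝ)) =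
      2 * (SimpleGraph.pathGraph (N + 1)).edgeFinset.card := by
    rw [← Nat.cast_sum, h]
    push_cast
    congr!
  linarith

/-- The potential of the pair of positions `i`, `j` on the path with `N + 1` nodes. -/
noncomputable def pathPotential (N : ℕ) (c : ℝ) (i j : Fin (N + 1)) : ℝ :=
  N / 4 * (c - (min i.val j.val : ℕ) * ((min i.val j.val : ℕ) + 1) -
    (N - (max i.val j.val : ℕ)) * (N - (max i.val j.val : ℕ) + 1))

lemma pathPotential_comm (N : ℕ) (c : ℝ) (i j : Fin (N + 1)) :
    pathPotential N c i j = pathPotential N c j i := by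
  rw [pathPotential, pathPotential, min_comm, max_comm]

lemma pathPotential_of_lt (N : ℕ) (c : ℝ) {i j : Fin (N + 1)} (hij : i.val < j.val) :
    pathPotential N c i j =
      N / 4 * (c - i.val * (i.val + 1) - (N - j.val) * (N - j.val + 1)) := by
  rw [pathPotential, min_eq_left hij.le, max_eq_right hij.le]

lemma edgeSum_comm {V : Type*} [DecidableEq V] (G : SimpleGraph V) [Fintype G.edgeSet]
    {Φ : V → V → ℝ} (hΦ : ∀ i j, Φ i j = Φ j i) (i j : V) :
    edgeSum G Φ i j = edgeSum G Φ j i := by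
  refine Finset.sum_congr rfl fun e _ => ?_
  rw [Sym2.eq_swap, hΦ]

/-- Each walker contributes second difference `-2`, and the factor `N / 4` makes the total `-N`. The
shape `a * (a + 1)` has zero increment across the missing edge at an end, so the boundary needs no
correction. -/
lemma edgeSum_pathPotential (N : ℕ) [Fintype (SimpleGraph.pathGraph (N + 1)).edgeSet] (c : ℝ)
    {i j : Fin (N + 1)} (hij : i.val < j.val) :
    edgeSum (SimpleGraph.pathGraph (N + 1)) (pathPotential N c) i j -
        (SimpleGraph.pathGraph (N + 1)).edgeFinset.card * pathPotential N c i j =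
      if i.val + 1 = j.val then
        N / 4 * (2 * i.val + 2 * (N - j.val)) - pathPotential N c i j
      else -N := by
  classical
  have hne : i ≠ j := fun h => hij.ne (congrArg _ h)
  have hjN := j.isLt
  rw [edgeSum_sub _ _ hne, Finset.sum_filter, sum_neighborFinset_pathGraph,
    sum_neighborFinset_pathGraph, dif_pos (show i.val + 1 < N + 1 by omega),
    if_pos (show 0 < j.val by omega)]
  have hL : (if 0 < i.val then
      ((if (⟨i.val - 1, by omega⟩ : Fin (N + 1)) = j then (0 : ℝ) else
        pathPotential N c ⟨i.val - 1, by omega⟩ j) - pathPotential N c i j) else 0) =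
      N / 4 * (2 * i.val) := by
    split_ifs with h h'
    · rw [Fin.ext_iff] at h'
      simp only at h'
      omega
    · rw [pathPotential_of_lt N c hij,
        pathPotential_of_lt N c (show (⟨i.val - 1, by omega⟩ : Fin (N + 1)).val < j.val by
          simp only; omega)]
      simp only
      rw [Nat.cast_sub h]
      push_cast
      ring
    · have : i.val = 0 := by omega
      simp [this]
  have hR : (if h : j.val + 1 < N + 1 then
      (if (⟨j.val + 1, h⟩ : Fin (N + 1)) ≠ i then
        pathPotential N c i ⟨j.val + 1, h⟩ - pathPotential N c i j else 0) else 0) =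
      N / 4 * (2 * (N - j.val)) := by
    split_ifs with h h'
    · rw [pathPotential_of_lt N c hij,
        pathPotential_of_lt N c (show i.val < (⟨j.val + 1, h⟩ : Fin (N + 1)).val by
          simp only; omega)]
      simp only
      push_cast
      ring
    · rw [not_not, Fin.ext_iff] at h'
      simp only at h'
      omega
    · have : j.val = N := by omega
      simp [this]
  rw [hL, hR]
  by_cases h : i.val + 1 = j.val
  · rw [if_pos h, if_pos (Fin.ext h), if_neg]
    · ring
    · rw [not_not, Fin.ext_iff]
      simp only
      omega
  · rw [if_neg h, if_neg (fun h' => h (Fin.ext_iff.1 h')), if_pos, pathPotential_of_lt N c hij,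
      pathPotential_of_lt N c (show (⟨i.val + 1, by omega⟩ : Fin (N + 1)).val < j.val by
          simp only; omega),
      pathPotential_of_lt N c (show i.val < (⟨j.val - 1, by omega⟩ : Fin (N + 1)).val by
          simp only; omega)]
    · simp only
      rw [Nat.cast_sub (show 1 ≤ j.val by omega)]
      push_cast
      ring
    · rw [Ne, Fin.ext_iff]
      simp only
      omega

lemma pathGraph_edgeSet_nonempty {N : ℕ} (hN : 1 ≤ N) :
    (SimpleGraph.pathGraph (N + 1)).edgeSet.Nonempty := by
  refine ⟨s(⟨0, by omega⟩, ⟨1, by omega⟩), ?_⟩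
  rw [SimpleGraph.mem_edgeSet, SimpleGraph.pathGraph_adj]
  simp

lemma forall_ne_of_lt {N : ℕ} {P : Fin (N + 1) → Fin (N + 1) → Prop}
    (hP : ∀ i j, P i j → P j i) (h : ∀ i j, i.val < j.val → P i j) (i j : Fin (N + 1))
    (hij : i ≠ j) : P i j := by
  rcases lt_or_gt_of_ne (fun h => hij (Fin.ext h) : i.val ≠ j.val) with h' | h'
  · exact h i j h'
  · exact hP _ _ (h j i h')

/-- For adjacent walkers at distances `a`, `b` from the ends, `a + b = N - 1`, the supersolution
condition reads `c ≥ a ^ 2 + b ^ 2 + 3 * N + 1`. The worst case `a * b = 0` gives this `c`. -/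
lemma maxExpectedTime_pathGraph_le {N : ℕ} (hN : 1 ≤ N) :
    maxExpectedTime (SimpleGraph.pathGraph (N + 1)) ≤
      ENNReal.ofReal (N / 4 * (N ^ 2 + N + 2)) := by
  classical
  set c : ℝ := N ^ 2 + N + 2 with hc
  have hn : (1 : ℝ) ≤ N := by exact_mod_cast hN
  have hsum : ∀ i j : Fin (N + 1), i.val < j.val →
      (i.val : ℝ) * (i.val + 1) + (N - j.val) * (N - j.val + 1) ≤ (N - 1) * N := by
    intro i j hij
    have h1 : (i.val : ℝ) + 1 ≤ j.val := by exact_mod_cast hij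
    have h2 : (j.val : ℝ) ≤ N := by exact_mod_cast Nat.lt_succ_iff.1 j.isLt
    have h3 : (0 : ℝ) ≤ i.val := Nat.cast_nonneg _
    nlinarith [mul_nonneg h3 (sub_nonneg.2 h2)]
  refine iSup₂_le fun x hx => ?_
  obtain ⟨i, j, hij, rfl⟩ := mem_extremalProfiles.1 hx
  refine (lintegral_firstNontrivialTime_le _ (pathGraph_edgeSet_nonempty hN)
    (Φ := pathPotential N c) ?_ ?_ hij).trans (ENNReal.ofReal_le_ofReal ?_)
  · refine forall_ne_of_lt (fun i j h => by rwa [pathPotential_comm]) fun i j hij => ?_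
    rw [pathPotential_of_lt N c hij]
    refine mul_nonneg (by positivity) ?_
    have := hsum i j hij
    rw [hc]
    nlinarith
  · refine forall_ne_of_lt (fun i j h => by
      rwa [pathPotential_comm, edgeSum_comm _ (pathPotential_comm N c)]) fun i j hij => ?_
    have h := edgeSum_pathPotential N c hij
    rw [card_edgeFinset_pathGraph] at h ⊢
    split_ifs at h with h'
    · rw [pathPotential_of_lt N c hij] at h ⊢
      have h1 := hsum i j hij
      have h2 : (j.val : ℝ) = i.val + 1 := by exact_mod_cast h'.symm
      rw [h2] at h h1 ⊢
      nlinarith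
    · linarith
  · refine forall_ne_of_lt (P := fun i j => pathPotential N c i j ≤ _)
      (fun i j h => by rwa [pathPotential_comm]) (fun i j hij => ?_) i j hij
    rw [pathPotential_of_lt N c hij]
    refine mul_le_mul_of_nonneg_left ?_ (by positivity)
    have h2 : (j.val : ℝ) ≤ N := by exact_mod_cast Nat.lt_succ_iff.1 j.isLt
    have h3 : (0 : ℝ) ≤ i.val := Nat.cast_nonneg _
    nlinarith [sub_nonneg.2 h2]

/-- The condition at adjacent walkers is now reversed, and `a ^ 2 + b ^ 2 ≥ (N - 1) ^ 2 / 2` gives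
this `c`. The walkers start at the two ends, where the subtracted terms vanish. -/
lemma le_maxExpectedTime_pathGraph {N : ℕ} (hN : 1 ≤ N) :
    ENNReal.ofReal (N / 4 * ((N + 1) ^ 2 / 2 + (N + 1))) ≤
      maxExpectedTime (SimpleGraph.pathGraph (N + 1)) := by
  classical
  set c : ℝ := (N + 1) ^ 2 / 2 + (N + 1) with hc
  have hn : (1 : ℝ) ≤ N := by exact_mod_cast hN
  have h0N : (⟨0, by omega⟩ : Fin (N + 1)) ≠ ⟨N, by omega⟩ := by
    rw [Ne, Fin.ext_iff]
    simp only
    omega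
  have hval : pathPotential N c ⟨0, by omega⟩ ⟨N, by omega⟩ = N / 4 * c := by
    rw [pathPotential_of_lt N c (by simp only; omega)]
    simp
  rw [← hval]
  refine (le_lintegral_firstNontrivialTime _ (pathGraph_edgeSet_nonempty hN)
    (Φ := pathPotential N c) (K := N / 4 * c) ?_ ?_ h0N).trans
    (le_iSup₂_of_le _ (mem_extremalProfiles.2 ⟨_, _, h0N, rfl⟩) le_rfl)
  · refine forall_ne_of_lt (P := fun i j => pathPotential N c i j ≤ _)
      (fun i j h => by rwa [pathPotential_comm]) (fun i j hij => ?_)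
    rw [pathPotential_of_lt N c hij]
    refine mul_le_mul_of_nonneg_left ?_ (by positivity)
    have h2 : (j.val : ℝ) ≤ N := by exact_mod_cast Nat.lt_succ_iff.1 j.isLt
    have h3 : (0 : ℝ) ≤ i.val := Nat.cast_nonneg _
    nlinarith [sub_nonneg.2 h2]
  · refine forall_ne_of_lt (fun i j h => by
      rwa [pathPotential_comm, edgeSum_comm _ (pathPotential_comm N c)]) fun i j hij => ?_
    have h := edgeSum_pathPotential N c hij
    rw [card_edgeFinset_pathGraph] at h ⊢
    split_ifs at h with h'
    · rw [pathPotential_of_lt N c hij] at h ⊢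
      have h2 : (j.val : ℝ) = i.val + 1 := by exact_mod_cast h'.symm
      rw [h2] at h ⊢
      -- The square is `(a - b) ^ 2`, with equality for adjacent walkers in the middle.
      nlinarith [mul_nonneg (show (0 : ℝ) ≤ N by positivity)
        (sq_nonneg ((i.val : ℝ) - (N - (i.val + 1))))]
    · linarith

end Path

/-! ### The cycle -/

section Cycle

open Fin.CommRing in
lemma sum_neighborFinset_cycleGraph (n : ℕ)
    (i : Fin (n + 3)) (f : Fin (n + 3) → ℝ) :
    ∑ k ∈ (SimpleGraph.cycleGraph (n + 3)).neighborFinset i, f k = f (i - 1) + f (i + 1) := by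
  have h : i - 1 ≠ i + 1 := by
    intro h
    have h2 : (1 : Fin (n + 3)) + 1 = 0 := by
      linear_combination -h
    have := congrArg Fin.val h2
    simp [Fin.val_add, Nat.mod_eq_of_lt (show 1 + 1 < n + 3 by omega)] at this
  rw [SimpleGraph.cycleGraph_neighborFinset (n := n + 1), Finset.sum_pair h]

lemma card_edgeFinset_cycleGraph (n : ℕ) :
    ((SimpleGraph.cycleGraph (n + 3)).edgeFinset.card : ℝ) = n + 3 := by
  have h := (SimpleGraph.cycleGraph (n + 3)).sum_degrees_eq_twice_card_edges
  simp only [SimpleGraph.cycleGraph_degree_three_le] at h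
  simp only [Finset.sum_const, Finset.card_univ, Fintype.card_fin, smul_eq_mul] at h
  have h' : (SimpleGraph.cycleGraph (n + 3)).edgeFinset.card = n + 3 := by omega
  rw [h']
  push_cast
  ring

/-- The expected time on the cycle with `n + 3` nodes when the positions differ by `d`. -/
noncomputable def cyclePotential (n : ℕ) (d : Fin (n + 3)) : ℝ :=
  (n + 3) / 4 * (d.val * (n + 3 - d.val) + (n + 2))

open Fin.CommRing in
-- By rotation only the difference `d` matters; it changes by `±1`, each through two edges unless
-- the walkers are adjacent. The constant `n + 2` in the potential makes the equation hold at `d =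
-- 1` and `d = n + 2` too.
lemma edgeSum_cyclePotential (n : ℕ) {i j : Fin (n + 3)} (hij : i ≠ j) :
    edgeSum (SimpleGraph.cycleGraph (n + 3)) (fun i j => cyclePotential n (j - i)) i j -
      (SimpleGraph.cycleGraph (n + 3)).edgeFinset.card * cyclePotential n (j - i) =
      -(SimpleGraph.cycleGraph (n + 3)).edgeFinset.card := by
  rw [edgeSum_sub _ (fun i j => cyclePotential n (j - i)) hij, Finset.sum_filter,
    sum_neighborFinset_cycleGraph, sum_neighborFinset_cycleGraph, card_edgeFinset_cycleGraph]
  obtain ⟨d, rfl⟩ : ∃ d, j = i + d := ⟨j - i, by abel⟩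
  have hd : d ≠ 0 := fun h => hij (by simp [h])
  have hd0 : 1 ≤ d.val := Nat.one_le_iff_ne_zero.2 fun h => hd (Fin.ext h)
  have hdn := d.isLt
  have e1 : i + d - (i - 1) = d + 1 := by abel
  have e2 : i + d - (i + 1) = d - 1 := by abel
  have e3 : i + d - i = d := by abel
  have e4 : i + d - 1 - i = d - 1 := by abel
  have e5 : i + d + 1 - i = d + 1 := by abel
  have c1 : i - 1 = i + d ↔ d + 1 = 0 := by
    constructor <;> intro h <;> linear_combination -h
  have c2 : i + 1 = i + d ↔ d = 1 := by
    constructor <;> intro h <;> linear_combination -h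
  have c3 : i + d - 1 = i ↔ d = 1 := by
    constructor <;> intro h <;> linear_combination h
  have c4 : i + d + 1 = i ↔ d + 1 = 0 := by
    constructor <;> intro h <;> linear_combination h
  have v1 : d = 1 ↔ d.val = 1 := by
    rw [Fin.ext_iff, Fin.val_one]
  have v2 : (d - 1).val = d.val - 1 := by
    rw [Fin.val_sub_one_of_ne_zero hd]
  have v3 : d + 1 = 0 ↔ d.val = n + 2 := by
    rw [Fin.ext_iff, Fin.val_add_one]
    constructor
    · intro h
      split_ifs at h with h'
      · simp [h']
      · simp at h
    · intro h
      rw [if_pos (Fin.ext (by simp [h]))]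
      rfl
  have v4 : d.val ≠ n + 2 → (d + 1).val = d.val + 1 := by
    intro h
    rw [Fin.val_add_one, if_neg]
    rintro rfl
    simp at h
  simp only [e1, e2, e3, e4, e5, c1, c2, c3, c4, v1, v3, ne_eq, ite_not, cyclePotential, v2]
  rw [Nat.cast_sub hd0]
  -- The values `1` and `n + 2` are the two adjacent configurations, where one edge kills the chain.
  by_cases h1 : d.val = 1
  · have h2 : d.val ≠ n + 2 := by omega
    simp only [v4 h2, h1, if_true, if_neg (show ¬ (1 = n + 2) by omega)]
    push_cast
    ring
  · by_cases h2 : d.val = n + 2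
    · simp only [h2, if_true, if_neg (show ¬ (n + 2 = 1) by omega)]
      push_cast
      ring
    · simp only [if_neg h1, if_neg h2, v4 h2]
      push_cast
      ring

lemma cycleGraph_edgeSet_nonempty (n : ℕ) :
    (SimpleGraph.cycleGraph (n + 3)).edgeSet.Nonempty := by
  refine ⟨s(0, 1), ?_⟩
  rw [SimpleGraph.mem_edgeSet, SimpleGraph.cycleGraph_adj]
  simp

lemma cyclePotential_nonneg (n : ℕ) (d : Fin (n + 3)) : 0 ≤ cyclePotential n d := by
  have h2 : (d.val : ℝ) ≤ n + 3 := by exact_mod_cast d.isLt.le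
  have h3 : (0 : ℝ) ≤ d.val := Nat.cast_nonneg _
  have := mul_nonneg h3 (sub_nonneg.2 h2)
  unfold cyclePotential
  positivity

lemma cyclePotential_le (n : ℕ) (d : Fin (n + 3)) :
    cyclePotential n d ≤ (n + 3) / 4 * ((n + 3) ^ 2 / 4 + (n + 2)) := by
  refine mul_le_mul_of_nonneg_left ?_ (by positivity)
  nlinarith [sq_nonneg ((d.val : ℝ) * 2 - (n + 3))]

lemma lintegral_firstNontrivialTime_cycleGraph (n : ℕ) {i j : Fin (n + 3)} (hij : i ≠ j) :
    ∫⁻ ω, firstNontrivialTime (pairProfile i j) ω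
        ∂(edgeSequenceLaw (SimpleGraph.cycleGraph (n + 3))) =
      ENNReal.ofReal (cyclePotential n (j - i)) := by
  refine le_antisymm ?_ ?_
  · refine lintegral_firstNontrivialTime_le _ (cycleGraph_edgeSet_nonempty n)
      (Φ := fun i j => cyclePotential n (j - i)) (fun i j _ => cyclePotential_nonneg n _)
      (fun i j hij => ?_) hij
    have := edgeSum_cyclePotential n hij
    linarith
  · refine le_lintegral_firstNontrivialTime _ (cycleGraph_edgeSet_nonempty n)
      (Φ := fun i j => cyclePotential n (j - i)) (fun i j _ => cyclePotential_le n _)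
      (fun i j hij => ?_) hij
    have := edgeSum_cyclePotential n hij
    linarith

end Cycle

end QuantizedConsensus

/-! ### Absolute constants -/

theorem mainTheorem5 :
    ∃ C₁ C₂ : ℝ, 0 < C₁ ∧ C₁ < C₂ ∧
      (∀ n : ℕ, 2 ≤ n →
        ENNReal.ofReal (C₁ * (n : ℝ) ^ 3) ≤
            QuantizedConsensus.maxExpectedTime (SimpleGraph.pathGraph n) ∧
          QuantizedConsensus.maxExpectedTime (SimpleGraph.pathGraph n) ≤
            ENNReal.ofReal (C₂ * (n : ℝ) ^ 3)) ∧
      (∀ n : ℕ, 3 ≤ n →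
        ENNReal.ofReal (C₁ * (n : ℝ) ^ 3) ≤
            QuantizedConsensus.maxExpectedTime (SimpleGraph.cycleGraph n) ∧
          QuantizedConsensus.maxExpectedTime (SimpleGraph.cycleGraph n) ≤
            ENNReal.ofReal (C₂ * (n : ℝ) ^ 3)) := by
  refine ⟨1 / 16, 1, by norm_num, by norm_num, fun n hn => ?_, fun n hn => ?_⟩
  · obtain ⟨N, rfl⟩ : ∃ N, n = N + 1 := ⟨n - 1, by omega⟩
    have hN : 1 ≤ N := by omega
    have h1 : (1 : ℝ) ≤ N := by exact_mod_cast hN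
    refine ⟨le_trans (ENNReal.ofReal_le_ofReal ?_)
        (QuantizedConsensus.le_maxExpectedTime_pathGraph hN),
      (QuantizedConsensus.maxExpectedTime_pathGraph_le hN).trans
        (ENNReal.ofReal_le_ofReal ?_)⟩
    -- Here `1 / 16` suffices because `N ≥ (N + 1) / 2`.
    · push_cast
      nlinarith [mul_nonneg (sub_nonneg.2 h1) (sq_nonneg ((N : ℝ) + 1))]
    · push_cast
      have h0 : (0 : ℝ) ≤ N := by positivity
      nlinarith [pow_nonneg h0 2, pow_nonneg h0 3]
  · obtain ⟨m, rfl⟩ : ∃ m, n = m + 3 := ⟨n - 3, by omega⟩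
    have h0 : (0 : ℝ) ≤ m := by positivity
    constructor
    -- Nearly antipodal walkers: `d * (m + 3 - d)` is within `1 / 4` of `(m + 3) ^ 2 / 4`, and the
    -- term `m + 2` absorbs the parity loss.
    · set d : Fin (m + 3) := ⟨(m + 3) / 2, by omega⟩ with hd
      have hne : (0 : Fin (m + 3)) ≠ d := by
        intro h
        have := congrArg Fin.val h
        simp [hd] at this
        omega
      refine le_trans ?_ (le_iSup₂_of_le _
        (QuantizedConsensus.mem_extremalProfiles.2 ⟨0, d, hne, rfl⟩) le_rfl)
      rw [QuantizedConsensus.lintegral_firstNontrivialTime_cycleGraph m hne]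
      refine ENNReal.ofReal_le_ofReal ?_
      rw [sub_zero, QuantizedConsensus.cyclePotential]
      have hv : d.val = (m + 3) / 2 := rfl
      have hl : ((m : ℝ) + 3) - 1 ≤ 2 * d.val := by
        have : m + 3 ≤ 2 * d.val + 1 := by omega
        have : (m : ℝ) + 3 ≤ 2 * d.val + 1 := by exact_mod_cast this
        linarith
      have hr : 2 * (d.val : ℝ) ≤ m + 3 := by
        have : 2 * d.val ≤ m + 3 := by omega
        exact_mod_cast this
      have key : ((m : ℝ) + 3) ^ 2 / 4 ≤ d.val * (m + 3 - d.val) + (m + 2) := by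
        nlinarith
      push_cast
      have := mul_le_mul_of_nonneg_left key (show 0 ≤ ((m : ℝ) + 3) / 4 by positivity)
      linarith
    · refine iSup₂_le fun x hx => ?_
      obtain ⟨i, j, hij, rfl⟩ := QuantizedConsensus.mem_extremalProfiles.1 hx
      rw [QuantizedConsensus.lintegral_firstNontrivialTime_cycleGraph m hij]
      refine ENNReal.ofReal_le_ofReal ((QuantizedConsensus.cyclePotential_le m _).trans ?_)
      push_cast
      nlinarith [pow_nonneg h0 2, pow_nonneg h0 3]
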